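/- Let $n\ge 3$. The degree partition of a simple graph on $n$ vertices is the vector in $\mathbb{R}^n$ obtained by arranging its vertex degrees (including zeros) in weakly decreasing order. Let $\mathsf{DP}(n)\subseteq\mathbb{R}^n$ be the convex hull of the degree partitions of all simple graphs on $n$ vertices, and let $TP(n)$ be the set of degree partitions of threshold graphs on $n$ vertices, where a graph is threshold if every induced subgraph on a nonempty vertex set has a dominating vertex (adjacent to all the others) or an isolated vertex. An interval of $[n]=\{1,\dots,n\}$ is a nonempty set $\{i,i+1,\dots,j\}$ with $i\le j$; it is nontrivial if it has at least two elements. For a nontrivial interval $I$ let $\Omega_I\in\mathbb{R}^n$ be the vector with entries $\#I-1$ at the positions in $I$ and $0$ elsewhere. For two intervals $I,J$ with $\max I<\min J$ let $\Omega_{I,J}\in\mathbb{R}^n$ be the vector with entries $\#J$ at the positions in $I$, $\#I$ at the positions in $J$, and $0$ elsewhere. Let $d,e\in TP(n)$. Then $d$ and $e$ are adjacent extreme points of $\mathsf{DP}(n)$ (that is, they are distinct extreme points and the segment joining them is a face of $\mathsf{DP}(n)$) if and only if the following two conditions both hold: 1. $d$ and $e$ are comparable componentwise: $d_i\le e_i$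 for all $i$, or $e_i\le d_i$ for all $i$; 2. the vector $|d-e|=(|d_1-e_1|,\dots,|d_n-e_n|)$ equals $\Omega_I$ for some nontrivial interval $I$ of $[n]$, or equals $\Omega_{I,J}$ for some pair of intervals $I,J$ of $[n]$ with $\max I<\min J$. -/

import Mathlib

namespace DegreePartitions

open Classical in
/-- The degree sequence of a graph on `n` vertices, as a vector in `ℝⁿ`. -/
noncomputable def degreeSequence {n : ℕ} (G : SimpleGraph (Fin n)) : Fin n → ℝ :=
  fun v => (G.degree v : ℝ)

/-- `d` is the degree partition of `G`: its degree sequence, rearranged in weakly decreasing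
order (zero entries are kept). -/
def IsDegreePartition {n : ℕ} (G : SimpleGraph (Fin n)) (d : Fin n → ℝ) : Prop :=
  Antitone d ∧ ∃ σ : Equiv.Perm (Fin n), d = degreeSequence G ∘ σ

/-- `v` is adjacent to every other vertex. -/
def IsDominatingVertex {V : Type*} (G : SimpleGraph V) (v : V) : Prop :=
  ∀ w, w ≠ v → G.Adj v w

/-- `v` is adjacent to no vertex. -/
def IsIsolatedVertex {V : Type*} (G : SimpleGraph V) (v : V) : Prop :=
  ∀ w, ¬ G.Adj v w

/-- A graph is threshold if every induced subgraph (on a nonempty vertex set) has a dominating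
or an isolated vertex. -/
def IsThreshold {V : Type*} (G : SimpleGraph V) : Prop :=
  ∀ S : Set V, S.Nonempty →
    ∃ v : S, IsDominatingVertex (G.induce S) v ∨ IsIsolatedVertex (G.induce S) v

/-- The set `DP(n)` of degree partitions of simple graphs on `n` vertices. -/
def degreePartitions (n : ℕ) : Set (Fin n → ℝ) :=
  {d | ∃ G : SimpleGraph (Fin n), IsDegreePartition G d}

/-- The set `TP(n)` of threshold partitions: degree partitions of threshold graphs on `n`
vertices. -/
def thresholdPartitions (n : ℕ) : Set (Fin n → ℝ) :=
  {d | ∃ G : SimpleGraph (Fin n), IsThreshold G ∧ IsDegreePartition G d}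

/-- The polytope of degree partitions. -/
def degreePartitionPolytope (n : ℕ) : Set (Fin n → ℝ) :=
  convexHull ℝ (degreePartitions n)

/-- `x` and `y` are adjacent extreme points of `P`: distinct extreme points such that the segment
between them is a face of `P`, that is, the set of maximizers over `P` of a linear functional. -/
def AdjacentExtremePoints {n : ℕ} (P : Set (Fin n → ℝ)) (x y : Fin n → ℝ) : Prop :=
  x ∈ P.extremePoints ℝ ∧ y ∈ P.extremePoints ℝ ∧ x ≠ y ∧ IsExposed ℝ P (segment ℝ x y)

/-- A (nonempty) interval `{i, i+1, …, j}` of the index set. -/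
def IsInterval {n : ℕ} (I : Finset (Fin n)) : Prop :=
  ∃ i j : Fin n, i ≤ j ∧ I = Finset.Icc i j

/-- The vector `Ω_I`, equal to `#I - 1` on `I` and to `0` elsewhere. -/
def omega {n : ℕ} (I : Finset (Fin n)) : Fin n → ℝ :=
  fun i => if i ∈ I then (I.card : ℝ) - 1 else 0

/-- The vector `Ω_{I,J}`, equal to `#J` on `I`, to `#I` on `J` and to `0` elsewhere. -/
def omegaPair {n : ℕ} (I J : Finset (Fin n)) : Fin n → ℝ :=
  fun i => if i ∈ I then (J.card : ℝ) else if i ∈ J then (I.card : ℝ) else 0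

end DegreePartitions

namespace DegreePartitions

/-! Relabelling vertices by weakly decreasing degree turns a threshold graph into a shifted graph,
whose edges can be read off its degrees; each shifted graph gives an extreme point of the polytope.

A functional `w` evaluated on a degree sequence is the sum of `w i + w j` over the edges, so a graph
maximizes it exactly when it contains all pairs of positive sum and none of negative sum; the
zero-sum pairs are free. The polytope, however, is the hull of antitone degree vectors only, so an
exposing functional `c` need not be antitone. The Moreau decomposition `c = w + p` repairs this: `w`
is antitone, and `p` is nonpositive on antitone vectors and vanishes on the degree sequences of the
weight graphs of `w`. These graphs, one for each choice of classes of zero-sum pairs with a common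
absolute weight, therefore all give vertices of the face exposed by `c`. If the face is a segment
there can be only one class: a clique on the level set of `0`, or a complete bipartite graph between
the levels `s` and `-s`. Level sets of antitone vectors are intervals, so the difference is `Ω_I` or
`Ω_{I,J}` (`exists_weight_of_isExposed`, `weightGraph_sub_eq_omega`).

Conversely, a difference of this form determines the degrees on the intervals
(`natDegree_endpoints`). An explicit `w` then has the added edges as its only zero-sum pairs, and an
explicit `p` forces points of the face to be constant on the intervals; together they cut out the
segment (`isExposed_segment_of_omega`, `isExposed_segment_of_omegaPair`). -/

/-! ### Degrees and degree partitions. -/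

open Classical in
/-- The degree of a vertex, as a natural number. -/
noncomputable def natDegree {n : ℕ} (G : SimpleGraph (Fin n)) (i : Fin n) : ℕ :=
  (Finset.univ.filter (G.Adj i)).card

lemma degreeSequence_apply {n : ℕ} (G : SimpleGraph (Fin n)) (i : Fin n) :
    degreeSequence G i = (natDegree G i : ℝ) := by
  classical
  unfold degreeSequence natDegree
  rw [← SimpleGraph.card_neighborFinset_eq_degree, SimpleGraph.neighborFinset_eq_filter]

lemma natDegree_le_of_imp {n : ℕ} {G H : SimpleGraph (Fin n)} {i : Fin n}
    (h : ∀ j, G.Adj i j → H.Adj i j) : natDegree G i ≤ natDegree H i := by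
  classical
  unfold natDegree
  exact Finset.card_le_card fun j => by simpa using h j

lemma natDegree_lt_of_imp {n : ℕ} {G H : SimpleGraph (Fin n)} {i x : Fin n}
    (h : ∀ j, G.Adj i j → H.Adj i j) (hx : H.Adj i x) (hx' : ¬ G.Adj i x) :
    natDegree G i < natDegree H i := by
  classical
  unfold natDegree
  refine Finset.card_lt_card (Finset.ssubset_iff_of_subset (fun j => by simpa using h j) |>.2
    ⟨x, by simpa using hx, by simpa using hx'⟩)

lemma degreeSequence_mono {n : ℕ} {G H : SimpleGraph (Fin n)} (h : G ≤ H) :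
    degreeSequence G ≤ degreeSequence H := by
  intro i
  rw [degreeSequence_apply, degreeSequence_apply]
  exact Nat.cast_le.2 (natDegree_le_of_imp fun j hj => h hj)

/-- Vertices with nested neighbourhoods have ordered degrees. -/
lemma natDegree_le_of_neighbor_imp {n : ℕ} {G : SimpleGraph (Fin n)} {i k : Fin n}
    (h : ∀ j, j ≠ k → G.Adj i j → G.Adj k j) : natDegree G i ≤ natDegree G k := by
  classical
  unfold natDegree
  by_cases hik : G.Adj i k
  · have h1 := Finset.card_erase_add_one
      (show k ∈ Finset.univ.filter (G.Adj i) by simpa using hik)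
    have h2 := Finset.card_erase_add_one
      (show i ∈ Finset.univ.filter (G.Adj k) by simpa using hik.symm)
    have h3 : (Finset.univ.filter (G.Adj i)).erase k ⊆ (Finset.univ.filter (G.Adj k)).erase i := by
      intro j
      simp only [Finset.mem_erase, Finset.mem_filter, Finset.mem_univ, true_and]
      rintro ⟨hj, hij⟩
      exact ⟨hij.ne', h j hj hij⟩
    have := Finset.card_le_card h3
    omega
  · refine Finset.card_le_card fun j => ?_
    simp only [Finset.mem_filter, Finset.mem_univ, true_and]
    intro hij
    exact h j (by rintro rfl; exact hik hij) hij

lemma degreeSequence_comap {n : ℕ} (G : SimpleGraph (Fin n)) (σ : Equiv.Perm (Fin n)) :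
    degreeSequence (G.comap σ) = degreeSequence G ∘ σ := by
  classical
  funext i
  rw [Function.comp_apply, degreeSequence_apply, degreeSequence_apply]
  unfold natDegree
  congr 1
  refine Finset.card_bij (fun j _ => σ j) ?_ ?_ ?_
  · intro j hj; simpa using hj
  · intro j _ k _ h; exact σ.injective h
  · intro j hj; exact ⟨σ.symm j, by simpa using hj, by simp⟩

lemma mem_degreePartitions_iff {n : ℕ} {d : Fin n → ℝ} :
    d ∈ degreePartitions n ↔ Antitone d ∧ ∃ G : SimpleGraph (Fin n), d = degreeSequence G := by
  constructor
  · rintro ⟨G, hd, σ, rfl⟩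
    exact ⟨hd, G.comap σ, (degreeSequence_comap G σ).symm⟩
  · rintro ⟨hd, G, rfl⟩
    exact ⟨G, hd, 1, by simp⟩

/-! ### Shifted graphs and threshold graphs. -/

/-- A graph on `Fin n` is shifted if an endpoint of an edge may be replaced by a smaller one. -/
def IsShifted {n : ℕ} (G : SimpleGraph (Fin n)) : Prop :=
  ∀ i k j, k ≤ i → k ≠ j → G.Adj i j → G.Adj k j

lemma IsShifted.antitone {n : ℕ} {G : SimpleGraph (Fin n)} (hG : IsShifted G) :
    Antitone (degreeSequence G) := by
  intro k i hki
  rw [degreeSequence_apply, degreeSequence_apply]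
  exact_mod_cast natDegree_le_of_neighbor_imp fun j hj hij => hG i k j hki hj.symm hij

/-- If `ij` is an edge and `kj` is not, although `k` has at least the degree of `i`, then some `l`
is adjacent to `k` but not to `i`. On `{i, j, k, l}` the edges `ij`, `kl` and the non-edges `kj`,
`il` alternate, so no vertex is dominating or isolated there. -/
lemma IsThreshold.isShifted {n : ℕ} {G : SimpleGraph (Fin n)} (hG : IsThreshold G)
    (hd : Antitone (degreeSequence G)) : IsShifted G := by
  classical
  intro i k j hki hkj hij
  by_contra hkj'
  have hle : natDegree G i ≤ natDegree G k := by
    have := hd hki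
    rw [degreeSequence_apply, degreeSequence_apply] at this
    exact_mod_cast this
  obtain ⟨l, hkl, hil, hli⟩ : ∃ l, G.Adj k l ∧ ¬ G.Adj i l ∧ l ≠ i := by
    by_contra! hcon
    have hsub : Finset.univ.filter (G.Adj k) ⊆ Finset.univ.filter (G.Adj i) ∪ {i} := by
      intro l
      simp only [Finset.mem_union, Finset.mem_filter, Finset.mem_univ, true_and,
        Finset.mem_singleton]
      intro hl
      by_cases h : G.Adj i l
      · exact Or.inl h
      · exact Or.inr (hcon l hl h)
    -- Without such an `l`, the neighbours of `k` other than `i` are neighbours of `i`, while `j` is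
    -- a neighbour of `i` only. If `i` and `k` are adjacent, each is first removed from the other's
    -- neighbourhood.
    have hlt : natDegree G k < natDegree G i := by
      unfold natDegree
      by_cases hik : G.Adj i k
      · have h1 := Finset.card_erase_add_one
          (show k ∈ Finset.univ.filter (G.Adj i) by simpa using hik)
        have h2 := Finset.card_erase_add_one
          (show i ∈ Finset.univ.filter (G.Adj k) by simpa using hik.symm)
        have h3 : (Finset.univ.filter (G.Adj k)).erase i ⊂
            (Finset.univ.filter (G.Adj i)).erase k := by
          refine (Finset.ssubset_iff_of_subset ?_).2 ⟨j, ?_, ?_⟩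
          · intro l
            simp only [Finset.mem_erase, Finset.mem_filter, Finset.mem_univ, true_and]
            rintro ⟨hl, hkl⟩
            refine ⟨hkl.ne', ?_⟩
            by_contra h
            exact hl (hcon l hkl h)
          · simpa using ⟨hkj.symm, hij⟩
          · simp [hkj']
        have := Finset.card_lt_card h3
        omega
      · refine Finset.card_lt_card ((Finset.ssubset_iff_of_subset ?_).2 ⟨j, ?_, ?_⟩)
        · intro l
          simp only [Finset.mem_filter, Finset.mem_univ, true_and]
          intro hkl
          by_contra h
          have := hcon l hkl h
          subst this
          exact hik hkl.symm
        · simpa using hij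
        · simpa using hkj'
    omega
  obtain ⟨⟨v, hv⟩, h⟩ := hG {i, j, k, l} ⟨i, by simp⟩
  have hki' : k ≠ i := by rintro rfl; exact hkj' hij
  have hjl : j ≠ l := by rintro rfl; exact hkj' hkl
  rcases h with h | h
  · have key : ∀ x ∈ ({i, j, k, l} : Set (Fin n)), x ≠ v → G.Adj v x := fun x hx hxv => by
      simpa using h ⟨x, hx⟩ (by simpa [Subtype.ext_iff] using hxv)
    rcases hv with rfl | rfl | rfl | rfl
    · exact hil (key l (by simp) hli)
    · exact hkj' (key k (by simp) hkj).symm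
    · exact hkj' (key j (by simp) hkj.symm)
    · exact hil (key i (by simp) hli.symm).symm
  · have key : ∀ x ∈ ({i, j, k, l} : Set (Fin n)), ¬ G.Adj v x := fun x hx => by
      simpa using h ⟨x, hx⟩
    rcases hv with rfl | rfl | rfl | rfl
    · exact key j (by simp) hij
    · exact key i (by simp) hij.symm
    · exact key l (by simp) hkl
    · exact key k (by simp) hkl.symm

lemma IsThreshold.comap {n : ℕ} {G : SimpleGraph (Fin n)} (hG : IsThreshold G)
    (σ : Equiv.Perm (Fin n)) : IsThreshold (G.comap σ) := by
  intro S hS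
  obtain ⟨⟨v, x, hx, rfl⟩, h⟩ := hG (σ '' S) (hS.image σ)
  refine ⟨⟨x, hx⟩, h.imp ?_ ?_⟩
  · intro h w hw
    simpa using h ⟨σ w, w, w.2, rfl⟩ (by simpa [Subtype.ext_iff] using hw)
  · intro h w
    simpa using h ⟨σ w, w, w.2, rfl⟩

lemma exists_isShifted_of_mem_thresholdPartitions {n : ℕ} {d : Fin n → ℝ}
    (hd : d ∈ thresholdPartitions n) :
    ∃ G : SimpleGraph (Fin n), IsShifted G ∧ d = degreeSequence G := by
  obtain ⟨G, hG, hanti, σ, rfl⟩ := hd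
  rw [← degreeSequence_comap] at hanti ⊢
  exact ⟨_, (hG.comap σ).isShifted hanti, rfl⟩

/-- Neighbourhoods in a shifted graph are initial segments with the vertex itself removed. Since `i
< j`, exactly `j` vertices other than `i` are at most `j` (indices start at `0`). In `adj_iff_lt`
the removed vertex lies above the segment, whence the strict inequality there. -/
lemma IsShifted.adj_iff_le {n : ℕ} {G : SimpleGraph (Fin n)} (hG : IsShifted G) {i j : Fin n}
    (hij : i < j) : G.Adj i j ↔ (j : ℕ) ≤ natDegree G i := by
  classical
  have hji : i ∈ Finset.Iic j := by simpa using hij.le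
  constructor
  · intro h
    have hsub : (Finset.Iic j).erase i ⊆ Finset.univ.filter (G.Adj i) := by
      intro x
      simp only [Finset.mem_erase, Finset.mem_Iic, Finset.mem_filter, Finset.mem_univ, true_and]
      rintro ⟨hxi, hxj⟩
      exact (hG j x i hxj hxi h.symm).symm
    have := Finset.card_le_card hsub
    rw [Finset.card_erase_of_mem hji, Fin.card_Iic] at this
    simpa [natDegree] using this
  · intro h
    by_contra hn
    have hsub : Finset.univ.filter (G.Adj i) ⊆ (Finset.Iio j).erase i := by
      intro x
      simp only [Finset.mem_erase, Finset.mem_Iio, Finset.mem_filter, Finset.mem_univ, true_and]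
      intro hx
      refine ⟨hx.ne', ?_⟩
      by_contra hjx
      exact hn (hG x j i (not_lt.1 hjx) hij.ne' hx.symm).symm
    have := Finset.card_le_card hsub
    rw [Finset.card_erase_of_mem (by simpa using hij), Fin.card_Iio] at this
    unfold natDegree at h
    have : (i : ℕ) < j := hij
    omega

lemma IsShifted.adj_iff_lt {n : ℕ} {G : SimpleGraph (Fin n)} (hG : IsShifted G) {i j : Fin n}
    (hij : i < j) : G.Adj i j ↔ (i : ℕ) < natDegree G j := by
  classical
  constructor
  · intro h
    have hsub : Finset.Iic i ⊆ Finset.univ.filter (G.Adj j) := by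
      intro x
      simp only [Finset.mem_Iic, Finset.mem_filter, Finset.mem_univ, true_and]
      intro hx
      exact (hG i x j hx (hx.trans_lt hij).ne h).symm
    have := Finset.card_le_card hsub
    rw [Fin.card_Iic] at this
    exact this
  · intro h
    by_contra hn
    have hsub : Finset.univ.filter (G.Adj j) ⊆ Finset.Iio i := by
      intro x
      simp only [Finset.mem_Iio, Finset.mem_filter, Finset.mem_univ, true_and]
      intro hx
      by_contra hix
      exact hn (hG x i j (not_lt.1 hix) hij.ne hx.symm)
    have := Finset.card_le_card hsub
    rw [Fin.card_Iio] at this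
    unfold natDegree at h
    omega

/-! ### Linear functionals on degree sequences. -/

open Classical in
lemma two_mul_dotProduct_degreeSequence {n : ℕ} (w : Fin n → ℝ) (H : SimpleGraph (Fin n)) :
    2 * (w ⬝ᵥ degreeSequence H) = ∑ i, ∑ j, if H.Adj i j then w i + w j else 0 := by
  have h1 : w ⬝ᵥ degreeSequence H = ∑ i, ∑ j, if H.Adj i j then w i else 0 := by
    refine Finset.sum_congr rfl fun i _ => ?_
    rw [degreeSequence_apply, ← Finset.sum_filter, Finset.sum_const, nsmul_eq_mul, mul_comm]
    rfl
  have h2 : w ⬝ᵥ degreeSequence H = ∑ i, ∑ j, if H.Adj i j then w j else 0 := by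
    rw [h1, Finset.sum_comm]
    simp_rw [H.adj_comm]
  rw [two_mul]
  nth_rewrite 1 [h1]
  rw [h2, ← Finset.sum_add_distrib]
  refine Finset.sum_congr rfl fun i _ => ?_
  rw [← Finset.sum_add_distrib]
  refine Finset.sum_congr rfl fun j _ => ?_
  split_ifs <;> simp

/-- `G` maximizes the linear functional `w` over all degree sequences. -/
def IsOptimal {n : ℕ} (w : Fin n → ℝ) (G : SimpleGraph (Fin n)) : Prop :=
  ∀ i j, i ≠ j → (G.Adj i j → 0 ≤ w i + w j) ∧ (¬ G.Adj i j → w i + w j ≤ 0)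

lemma IsOptimal.le {n : ℕ} {w : Fin n → ℝ} {G : SimpleGraph (Fin n)} (hG : IsOptimal w G)
    (H : SimpleGraph (Fin n)) : w ⬝ᵥ degreeSequence H ≤ w ⬝ᵥ degreeSequence G := by
  classical
  have h1 := two_mul_dotProduct_degreeSequence w H
  have h2 := two_mul_dotProduct_degreeSequence w G
  have : (∑ i, ∑ j, if H.Adj i j then w i + w j else 0) ≤
      ∑ i, ∑ j, if G.Adj i j then w i + w j else 0 := by
    refine Finset.sum_le_sum fun i _ => Finset.sum_le_sum fun j _ => ?_
    rcases eq_or_ne i j with rfl | hij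
    · simp
    · have := hG i j hij
      split_ifs <;> grind
  linarith

/-- The comparison in `IsOptimal.le` is termwise, so equality of the sums forces equality of every
term: maximizers can differ only on zero-sum pairs. -/
lemma IsOptimal.adj_of_eq {n : ℕ} {w : Fin n → ℝ} {G H : SimpleGraph (Fin n)}
    (hG : IsOptimal w G) (h : w ⬝ᵥ degreeSequence H = w ⬝ᵥ degreeSequence G) (i j : Fin n)
    (hij : i ≠ j) : (0 < w i + w j → H.Adj i j) ∧ (w i + w j < 0 → ¬ H.Adj i j) := by
  classical
  have h1 := two_mul_dotProduct_degreeSequence w H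
  have h2 := two_mul_dotProduct_degreeSequence w G
  have hle : ∀ i j, (if H.Adj i j then w i + w j else 0) ≤
      if G.Adj i j then w i + w j else 0 := by
    intro i j
    rcases eq_or_ne i j with rfl | hij
    · simp
    · have := hG i j hij
      split_ifs <;> grind
  have heq : (∑ i, ∑ j, if H.Adj i j then w i + w j else 0) =
      ∑ i, ∑ j, if G.Adj i j then w i + w j else 0 := by rw [← h1, ← h2, h]
  rw [Finset.sum_eq_sum_iff_of_le fun i _ => Finset.sum_le_sum fun j _ => hle i j] at heq
  have h3 := heq i (Finset.mem_univ i)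
  rw [Finset.sum_eq_sum_iff_of_le fun j _ => hle i j] at h3
  have h4 := h3 j (Finset.mem_univ j)
  have := hG i j hij
  split_ifs at h4 <;> grind

/-- A convex set containing every generator on which a linear functional attains its bound also
contains every such point of the convex hull. -/
lemma mem_of_mem_convexHull_of_le {n : ℕ} {S T : Set (Fin n → ℝ)} (hT : Convex ℝ T)
    {c : Fin n → ℝ} {M : ℝ} (hM : ∀ s ∈ S, c ⬝ᵥ s ≤ M) (hST : ∀ s ∈ S, c ⬝ᵥ s = M → s ∈ T)
    {x : Fin n → ℝ} (hx : x ∈ convexHull ℝ S) : c ⬝ᵥ x ≤ M ∧ (c ⬝ᵥ x = M → x ∈ T) := by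
  have hconv : Convex ℝ {x : Fin n → ℝ | c ⬝ᵥ x ≤ M ∧ (c ⬝ᵥ x = M → x ∈ T)} := by
    rw [convex_iff_forall_pos]
    rintro x ⟨hx, hx'⟩ y ⟨hy, hy'⟩ a b ha hb hab
    have e : c ⬝ᵥ (a • x + b • y) = a * (c ⬝ᵥ x) + b * (c ⬝ᵥ y) := by
      simp [dotProduct_add, dotProduct_smul]
    have hMab : M = a * M + b * M := by rw [← add_mul, hab, one_mul]
    have h1 := mul_le_mul_of_nonneg_left hx ha.le
    have h2 := mul_le_mul_of_nonneg_left hy hb.le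
    refine ⟨by rw [e]; linarith, fun h => ?_⟩
    rw [e] at h
    refine hT (hx' ?_) (hy' ?_) ha.le hb.le hab
    · exact mul_left_cancel₀ ha.ne' (by linarith)
    · exact mul_left_cancel₀ hb.ne' (by linarith)
  exact convexHull_min (fun s hs => And.intro (hM s hs) (hST s hs)) hconv hx

/-- The linear functional given by the dot product with `c`. -/
noncomputable def dotFunctional {n : ℕ} (c : Fin n → ℝ) : StrongDual ℝ (Fin n → ℝ) :=
  LinearMap.toContinuousLinearMap (dotProductBilin ℝ ℝ c)

lemma dotFunctional_apply {n : ℕ} (c x : Fin n → ℝ) : dotFunctional c x = c ⬝ᵥ x := rfl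

/-! ### Shifted graphs give extreme points. -/

lemma IsShifted.mem_degreePartitions {n : ℕ} {G : SimpleGraph (Fin n)} (hG : IsShifted G) :
    degreeSequence G ∈ degreePartitions n :=
  mem_degreePartitions_iff.2 ⟨hG.antitone, G, rfl⟩

/-- For the weight `deg i - i`, the two adjacency criteria add up, for `i < j`, to `w i + w j > 0`
on edges and `w i + w j < 0` on non-edges. No pair has sum zero, so `G` is the only maximizer. -/
lemma IsShifted.mem_extremePoints {n : ℕ} {G : SimpleGraph (Fin n)} (hG : IsShifted G) :
    degreeSequence G ∈ (degreePartitionPolytope n).extremePoints ℝ := by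
  set w : Fin n → ℝ := fun i => degreeSequence G i - (i : ℕ) with hw
  have hlt : ∀ i j, i < j → (G.Adj i j → 0 < w i + w j) ∧ (¬ G.Adj i j → w i + w j < 0) := by
    intro i j hij
    have h1 := hG.adj_iff_le hij
    have h2 := hG.adj_iff_lt hij
    simp only [hw, degreeSequence_apply]
    constructor
    · intro h
      have h1 : ((j : ℕ) : ℝ) ≤ natDegree G i := by exact_mod_cast h1.1 h
      have h2 : ((i : ℕ) : ℝ) < natDegree G j := by exact_mod_cast h2.1 h
      linarith
    · intro h
      have h2 := not_lt.1 (mt h2.2 h)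
      rw [h1, not_le] at h
      have h : (natDegree G i : ℝ) < (j : ℕ) := by exact_mod_cast h
      have h2 : (natDegree G j : ℝ) ≤ (i : ℕ) := by exact_mod_cast h2
      linarith
  have hstrict : ∀ i j, i ≠ j →
      (G.Adj i j → 0 < w i + w j) ∧ (¬ G.Adj i j → w i + w j < 0) := by
    intro i j hij
    rcases lt_or_gt_of_ne hij with h | h
    · exact hlt i j h
    · rw [add_comm, G.adj_comm]; exact hlt j i h
  have hopt : IsOptimal w G := fun i j hij =>
    ⟨fun h => ((hstrict i j hij).1 h).le, fun h => ((hstrict i j hij).2 h).le⟩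
  have key : ∀ x ∈ degreePartitionPolytope n, w ⬝ᵥ x ≤ w ⬝ᵥ degreeSequence G ∧
      (w ⬝ᵥ x = w ⬝ᵥ degreeSequence G → x ∈ ({degreeSequence G} : Set (Fin n → ℝ))) := by
    intro x hx
    refine mem_of_mem_convexHull_of_le (convex_singleton _) ?_ ?_ hx
    · rintro s hs
      obtain ⟨-, H, rfl⟩ := mem_degreePartitions_iff.1 hs
      exact hopt.le H
    · rintro s hs hs'
      obtain ⟨-, H, rfl⟩ := mem_degreePartitions_iff.1 hs
      have : H = G := by
        ext i j
        rcases eq_or_ne i j with rfl | hij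
        · simp
        · have h1 := hopt.adj_of_eq hs' i j hij
          have h2 := hstrict i j hij
          tauto
      rw [this]; rfl
  refine ⟨subset_convexHull ℝ _ hG.mem_degreePartitions, ?_⟩
  rintro x hx y hy ⟨a, b, ha, hb, hab, he⟩
  have e : w ⬝ᵥ degreeSequence G = a * (w ⬝ᵥ x) + b * (w ⬝ᵥ y) := by
    rw [← he]; simp [dotProduct_add, dotProduct_smul]
  have h1 := mul_le_mul_of_nonneg_left (key x hx).1 ha.le
  have h2 := mul_le_mul_of_nonneg_left (key y hy).1 hb.le
  have h3 : w ⬝ᵥ degreeSequence G = a * (w ⬝ᵥ degreeSequence G) + b * (w ⬝ᵥ degreeSequence G) := by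
    rw [← add_mul, hab, one_mul]
  exact (key x hx).2 (mul_left_cancel₀ ha.ne' (by linarith))

/-! ### Splitting off the polar of the antitone cone. -/

/-- Moreau decomposition with respect to the cone of antitone vectors. -/
lemma exists_antitone_decomposition {n : ℕ} (c : Fin n → ℝ) :
    ∃ w p : Fin n → ℝ, c = w + p ∧ Antitone w ∧ p ⬝ᵥ w = 0 ∧ ∀ g, Antitone g → p ⬝ᵥ g ≤ 0 := by
  let K : Set (EuclideanSpace ℝ (Fin n)) := {x | ∀ i j, i ≤ j → x j ≤ x i}
  have hK : Convex ℝ K := by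
    intro x hx y hy a b ha hb _ i j hij
    have h1 := mul_le_mul_of_nonneg_left (hx i j hij) ha
    have h2 := mul_le_mul_of_nonneg_left (hy i j hij) hb
    simpa using add_le_add h1 h2
  have hKc : IsClosed K := by
    simp only [K, Set.ofPred_forall]
    refine isClosed_iInter fun i => isClosed_iInter fun j => isClosed_iInter fun _ => ?_
    exact isClosed_le (by fun_prop) (by fun_prop)
  obtain ⟨v, hv, hmin⟩ := exists_norm_eq_iInf_of_complete_convex (K := K) ⟨0, by simp [K]⟩
    hKc.isComplete hK (WithLp.toLp 2 c)
  rw [norm_eq_iInf_iff_real_inner_le_zero hK hv] at hmin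
  have hin : ∀ g : Fin n → ℝ, Antitone g → (fun i => c i - v i) ⬝ᵥ (fun i => g i - v i) ≤ 0 := by
    intro g hg
    have := hmin (WithLp.toLp 2 g) (fun i j hij => hg hij)
    rw [PiLp.inner_apply] at this
    simpa [dotProduct, mul_comm] using this
  have hva : Antitone fun i => v i := fun i j hij => hv i j hij
  -- Testing the projection inequality at `0` and at `2v` gives both signs of the product of `c - v`
  -- with `v`, hence orthogonality.
  have h0 := hin 0 antitone_const
  have h2 := hin (fun i => v i + v i) (hva.add hva)
  have hzero : (fun i => c i - v i) ⬝ᵥ (fun i => v i) = 0 := by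
    have e1 : (fun i => (0 : Fin n → ℝ) i - v i) = -(fun i => v i) := by funext i; simp
    have e2 : (fun i => v i + v i - v i) = fun i => v i := by funext i; simp
    rw [e1, dotProduct_neg] at h0
    rw [e2] at h2
    linarith
  refine ⟨fun i => v i, fun i => c i - v i, by funext i; simp, hva, hzero, fun g hg => ?_⟩
  have := hin g hg
  have e : (fun i => g i - v i) = g - fun i => v i := rfl
  rw [e, dotProduct_sub, hzero] at this
  linarith

/-- If `p` is in the polar of the antitone cone and orthogonal to `w`, it is orthogonal to every
weakly increasing function of `w`. -/
lemma dotProduct_eq_zero_of_mono {n : ℕ} {w p g : Fin n → ℝ} (hw : Antitone w)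
    (hpw : p ⬝ᵥ w = 0) (hp : ∀ g, Antitone g → p ⬝ᵥ g ≤ 0) (hg : ∀ i j, w i ≤ w j → g i ≤ g j) :
    p ⬝ᵥ g = 0 := by
  -- For small `ε > 0` the vector `w - ε g` is still antitone: where `w` is constant so is `g`, and
  -- strict drops of `w` survive. Polarity applied to it gives `p ⬝ᵥ g ≥ 0`.
  have hev : ∀ᶠ ε in nhdsWithin (0 : ℝ) (Set.Ioi 0), ∀ i j, i ≤ j →
      w j - ε * g j ≤ w i - ε * g i := by
    rw [Filter.eventually_all]; intro i
    rw [Filter.eventually_all]; intro j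
    by_cases hij : i ≤ j
    · rcases (hw hij).eq_or_lt with h | h
      · refine Filter.Eventually.of_forall fun ε _ => ?_
        rw [h, le_antisymm (hg i j h.ge) (hg j i h.le)]
      · have : Filter.Tendsto (fun ε : ℝ => (w i - ε * g i) - (w j - ε * g j)) (nhds 0)
            (nhds ((w i - 0 * g i) - (w j - 0 * g j))) := by
          apply Continuous.tendsto; fun_prop
        have h2 := this.eventually (lt_mem_nhds (show 0 < _ by linarith))
        filter_upwards [nhdsWithin_le_nhds h2] with ε hε _
        linarith
    · exact Filter.Eventually.of_forall fun ε h => absurd h hij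
  obtain ⟨ε, hε, hpos⟩ := (hev.and self_mem_nhdsWithin).exists
  have h1 := hp (w - ε • g) fun i j hij => by simpa using hε i j hij
  rw [dotProduct_sub, dotProduct_smul, hpw, smul_eq_mul] at h1
  have h2 := hp g fun i j hij => hg j i (hw hij)
  have hpos : 0 < ε := hpos
  nlinarith

/-! ### Weight graphs. -/

/-- The graph whose edges are the pairs of positive weight, and those pairs of weight zero whose
members have absolute weight in `P`. -/
def weightGraph {n : ℕ} (w : Fin n → ℝ) (P : ℝ → Prop) : SimpleGraph (Fin n) where
  Adj i j := i ≠ j ∧ (0 < w i + w j ∨ (w i + w j = 0 ∧ P |w i|))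
  symm := ⟨by
    rintro i j ⟨hij, h⟩
    refine ⟨hij.symm, ?_⟩
    rw [add_comm]
    refine h.imp_right fun h => ⟨h.1, ?_⟩
    rw [show w j = - w i by linarith [h.1], abs_neg]
    exact h.2⟩
  loopless := ⟨fun i h => h.1 rfl⟩

lemma weightGraph_adj {n : ℕ} {w : Fin n → ℝ} {P : ℝ → Prop} {i j : Fin n} :
    (weightGraph w P).Adj i j ↔ i ≠ j ∧ (0 < w i + w j ∨ (w i + w j = 0 ∧ P |w i|)) := Iff.rfl

lemma weightGraph_adj_mono {n : ℕ} {w : Fin n → ℝ} {P : ℝ → Prop} {i k j : Fin n}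
    (hik : w i ≤ w k) (hkj : k ≠ j) (h : (weightGraph w P).Adj i j) :
    (weightGraph w P).Adj k j := by
  rw [weightGraph_adj] at h ⊢
  refine ⟨hkj, ?_⟩
  rcases h.2 with h | ⟨h, hP⟩
  · left; linarith
  · rcases hik.eq_or_lt with e | e
    · right; rw [← e]; exact ⟨h, hP⟩
    · left; linarith

lemma isShifted_weightGraph {n : ℕ} {w : Fin n → ℝ} (hw : Antitone w) (P : ℝ → Prop) :
    IsShifted (weightGraph w P) :=
  fun _ _ _ hki hkj h => weightGraph_adj_mono (hw hki) hkj h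

/-- This is the monotonicity hypothesis of `dotProduct_eq_zero_of_mono`; it makes the polar part `p`
vanish on all weight graphs. -/
lemma degreeSequence_weightGraph_mono {n : ℕ} (w : Fin n → ℝ) (P : ℝ → Prop) (i j : Fin n)
    (h : w i ≤ w j) :
    degreeSequence (weightGraph w P) i ≤ degreeSequence (weightGraph w P) j := by
  rw [degreeSequence_apply, degreeSequence_apply]
  exact_mod_cast natDegree_le_of_neighbor_imp fun k hk hik => weightGraph_adj_mono h hk.symm hik

lemma isOptimal_weightGraph {n : ℕ} (w : Fin n → ℝ) (P : ℝ → Prop) :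
    IsOptimal w (weightGraph w P) := by
  intro i j hij
  rw [weightGraph_adj]
  constructor
  · rintro ⟨-, h | ⟨h, -⟩⟩
    · exact h.le
    · exact h.ge
  · intro h
    by_contra hcon
    exact h ⟨hij, Or.inl (not_le.1 hcon)⟩

lemma weightGraph_mono {n : ℕ} (w : Fin n → ℝ) {P Q : ℝ → Prop} (h : ∀ x, P x → Q x) :
    weightGraph w P ≤ weightGraph w Q := by
  intro i j hij
  rw [weightGraph_adj] at hij ⊢
  exact ⟨hij.1, hij.2.imp_right fun h' => ⟨h'.1, h _ h'.2⟩⟩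

open Classical in
/-- Level sets of antitone vectors are intervals. -/
lemma isInterval_level {n : ℕ} {w : Fin n → ℝ} (hw : Antitone w) (s : ℝ) (hs : ∃ i, w i = s) :
    IsInterval (Finset.univ.filter fun i => w i = s) := by
  have hne : (Finset.univ.filter fun i => w i = s).Nonempty := by
    obtain ⟨i, hi⟩ := hs
    exact ⟨i, by simpa using hi⟩
  refine ⟨Finset.min' _ hne, Finset.max' _ hne, Finset.min'_le_max' _ hne, ?_⟩
  have h1 : w (Finset.min' _ hne) = s := by simpa using Finset.min'_mem _ hne
  have h2 : w (Finset.max' _ hne) = s := by simpa using Finset.max'_mem _ hne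
  ext i
  rw [Finset.mem_Icc]
  constructor
  · exact fun hi => ⟨Finset.min'_le _ _ hi, Finset.le_max' _ _ hi⟩
  · rintro ⟨ha, hb⟩
    have h3 := hw ha
    have h4 := hw hb
    simp only [Finset.mem_filter, Finset.mem_univ, true_and]
    linarith

open Classical in
lemma degreeSequence_weightGraph_sub {n : ℕ} (w : Fin n → ℝ) (i : Fin n) :
    degreeSequence (weightGraph w fun _ => True) i -
      degreeSequence (weightGraph w fun _ => False) i =
      ((Finset.univ.filter fun j => i ≠ j ∧ w i + w j = 0).card : ℝ) := by
  rw [degreeSequence_apply, degreeSequence_apply, sub_eq_iff_eq_add']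
  have hd : Disjoint (Finset.univ.filter ((weightGraph w fun _ => False).Adj i))
      (Finset.univ.filter fun j => i ≠ j ∧ w i + w j = 0) := by
    rw [Finset.disjoint_filter]
    rintro j - h ⟨-, h'⟩
    rw [weightGraph_adj] at h
    simp [h'] at h
  have := Finset.card_union_of_disjoint hd
  unfold natDegree
  rw [← Nat.cast_add, ← this]
  congr 2
  ext j
  simp only [Finset.mem_filter, Finset.mem_univ, true_and, Finset.mem_union, weightGraph_adj]
  tauto

/-- If all zero-sum pairs have the same absolute weight, the two extreme weight graphs differ by
a vector `Ω_I` or `Ω_{I,J}`. -/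
lemma weightGraph_sub_eq_omega {n : ℕ} {w : Fin n → ℝ} (hw : Antitone w) {a b : Fin n}
    (hab : a ≠ b) (hsum : w a + w b = 0) {s : ℝ} (hs : 0 ≤ s)
    (hall : ∀ i j, i ≠ j → w i + w j = 0 → |w i| = s) :
    (∃ I : Finset (Fin n), IsInterval I ∧ 2 ≤ I.card ∧
      degreeSequence (weightGraph w fun _ => True) -
        degreeSequence (weightGraph w fun _ => False) = omega I) ∨
    (∃ I J : Finset (Fin n), IsInterval I ∧ IsInterval J ∧ (∀ i ∈ I, ∀ j ∈ J, i < j) ∧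
      degreeSequence (weightGraph w fun _ => True) -
        degreeSequence (weightGraph w fun _ => False) = omegaPair I J) := by
  classical
  have ha := hall a b hab hsum
  have hzero : ∀ i, |w i| ≠ s → (Finset.univ.filter fun j => i ≠ j ∧ w i + w j = 0) = ∅ := by
    intro i hi
    rw [Finset.filter_eq_empty_iff]
    rintro j - ⟨hij, h⟩
    exact hi (hall i j hij h)
  -- For `s = 0` the zero-sum pairs form a clique on the zero level; for `s > 0` they form a
  -- complete bipartite graph between the levels `s` and `-s`.
  rcases hs.eq_or_lt with rfl | hs
  · left
    have ha : w a = 0 := abs_eq_zero.1 ha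
    have hb : w b = 0 := by linarith
    refine ⟨Finset.univ.filter fun i => w i = 0, isInterval_level hw 0 ⟨a, ha⟩, ?_, ?_⟩
    · exact Finset.one_lt_card.2 ⟨a, by simpa using ha, b, by simpa using hb, hab⟩
    · funext i
      rw [Pi.sub_apply, degreeSequence_weightGraph_sub]
      unfold omega
      by_cases hi : w i = 0
      · rw [if_pos (by simpa using hi), eq_sub_iff_add_eq]
        have := Finset.card_erase_add_one
          (show i ∈ Finset.univ.filter fun j => w j = 0 by simpa using hi)
        rw [← this]
        push_cast
        congr 3
        ext j
        simp [hi, eq_comm]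
      · rw [if_neg (by simpa using hi), hzero i (by simpa using hi)]
        simp
  · right
    have hpm : ∃ i j, w i = s ∧ w j = -s := by
      rcases abs_choice (w a) with h | h
      · exact ⟨a, b, by linarith, by linarith⟩
      · exact ⟨b, a, by linarith, by linarith⟩
    obtain ⟨x, y, hx, hy⟩ := hpm
    refine ⟨Finset.univ.filter fun i => w i = s, Finset.univ.filter fun i => w i = -s,
      isInterval_level hw s ⟨x, hx⟩, isInterval_level hw (-s) ⟨y, hy⟩, ?_, ?_⟩
    · intro i hi j hj
      have hi : w i = s := by simpa using hi
      have hj : w j = -s := by simpa using hj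
      by_contra hcon
      have := hw (not_lt.1 hcon)
      linarith
    · funext i
      rw [Pi.sub_apply, degreeSequence_weightGraph_sub]
      unfold omegaPair
      by_cases hi : w i = s
      · rw [if_pos (by simpa using hi)]
        congr 2
        ext j
        simp only [Finset.mem_filter, Finset.mem_univ, true_and]
        constructor
        · rintro ⟨-, h⟩; linarith
        · intro h
          refine ⟨?_, by linarith⟩
          rintro rfl
          linarith
      · rw [if_neg (by simpa using hi)]
        by_cases hi' : w i = -s
        · rw [if_pos (by simpa using hi')]
          congr 2
          ext j
          simp only [Finset.mem_filter, Finset.mem_univ, true_and]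
          constructor
          · rintro ⟨-, h⟩; linarith
          · intro h
            refine ⟨?_, by linarith⟩
            rintro rfl
            exact hi h
        · rw [if_neg (by simpa using hi'), hzero i]
          · simp
          · intro h
            rcases abs_choice (w i) with h' | h'
            · exact hi (by linarith)
            · exact hi' (by linarith)

/-! ### Edges of the polytope come from weights. -/

lemma eq_or_eq_of_mem_segment {n : ℕ} {A : Set (Fin n → ℝ)} {d e g : Fin n → ℝ}
    (hd : d ∈ A) (he : e ∈ A) (hg : g ∈ A.extremePoints ℝ) (h : g ∈ segment ℝ d e) :
    g = d ∨ g = e := by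
  have := (mem_extremePoints_iff_forall_segment.1 hg).2 d hd e he h
  rcases this with h | h
  · exact Or.inl h.symm
  · exact Or.inr h.symm

/-- The endpoints of an edge of the polytope are the extreme weight graphs of a suitable weight,
all of whose zero-sum pairs have the same absolute weight. -/
lemma exists_weight_of_isExposed {n : ℕ} {D E : SimpleGraph (Fin n)} (hD : IsShifted D)
    (hE : IsShifted E) (hne : degreeSequence D ≠ degreeSequence E)
    (hexp : IsExposed ℝ (degreePartitionPolytope n)
      (segment ℝ (degreeSequence D) (degreeSequence E))) :
    ∃ w : Fin n → ℝ, Antitone w ∧ ∃ a b, a ≠ b ∧ w a + w b = 0 ∧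
      (∀ i j, i ≠ j → w i + w j = 0 → |w i| = |w a|) ∧
      ((degreeSequence D = degreeSequence (weightGraph w fun _ => False) ∧
        degreeSequence E = degreeSequence (weightGraph w fun _ => True)) ∨
      (degreeSequence E = degreeSequence (weightGraph w fun _ => False) ∧
        degreeSequence D = degreeSequence (weightGraph w fun _ => True))) := by
  have hDm : degreeSequence D ∈ degreePartitionPolytope n :=
    subset_convexHull ℝ _ hD.mem_degreePartitions
  have hEm : degreeSequence E ∈ degreePartitionPolytope n :=
    subset_convexHull ℝ _ hE.mem_degreePartitions
  obtain ⟨l, hl⟩ := hexp ⟨_, left_mem_segment ℝ _ _⟩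
  obtain ⟨c, hc⟩ : ∃ c : Fin n → ℝ, ∀ x, l x = c ⬝ᵥ x := by
    refine ⟨fun i => l (Pi.single i 1), fun x => ?_⟩
    conv_lhs => rw [pi_eq_sum_univ' x]
    simp [dotProduct, map_sum, mul_comm]
  obtain ⟨w, p, rfl, hw, hpw, hp⟩ := exists_antitone_decomposition c
  have hpg : ∀ P, p ⬝ᵥ degreeSequence (weightGraph w P) = 0 := fun P =>
    dotProduct_eq_zero_of_mono hw hpw hp (degreeSequence_weightGraph_mono w P)
  have hmem : ∀ P, degreeSequence (weightGraph w P) ∈ degreePartitionPolytope n := fun P =>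
    subset_convexHull ℝ _ (isShifted_weightGraph hw P).mem_degreePartitions
  have hmax : ∀ P, ∀ y ∈ degreePartitionPolytope n,
      (w + p) ⬝ᵥ y ≤ (w + p) ⬝ᵥ degreeSequence (weightGraph w P) := by
    intro P y hy
    refine (mem_of_mem_convexHull_of_le convex_univ ?_ (fun _ _ _ => trivial) hy).1
    intro s hs
    obtain ⟨hs, H, rfl⟩ := mem_degreePartitions_iff.1 hs
    rw [add_dotProduct, add_dotProduct, hpg]
    exact add_le_add ((isOptimal_weightGraph w P).le H) (hp _ hs)
  -- Every weight graph maximizes `w + p`, hence lies on the segment; being extreme, it is one of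
  -- the two endpoints.
  have hseg : ∀ P, degreeSequence (weightGraph w P) = degreeSequence D ∨
      degreeSequence (weightGraph w P) = degreeSequence E := by
    intro P
    refine eq_or_eq_of_mem_segment hDm hEm (isShifted_weightGraph hw P).mem_extremePoints ?_
    rw [hl]
    refine ⟨hmem P, fun y hy => ?_⟩
    rw [hc, hc]
    exact hmax P y hy
  -- On the face, `p ⬝ᵥ degreeSequence H ≤ 0` forces `H` to maximize `w` by itself, so `H` is
  -- determined away from the zero-sum pairs.
  have hbetween : ∀ H : SimpleGraph (Fin n), IsShifted H →
      degreeSequence H ∈ segment ℝ (degreeSequence D) (degreeSequence E) →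
      weightGraph w (fun _ => False) ≤ H ∧ H ≤ weightGraph w (fun _ => True) := by
    intro H hH hHs
    rw [hl] at hHs
    have h1 := hHs.2 _ (hmem fun _ => True)
    rw [hc, hc, add_dotProduct, add_dotProduct, hpg] at h1
    have h2 := hp _ hH.antitone
    have h3 := (isOptimal_weightGraph w fun _ => True).le H
    have h4 := (isOptimal_weightGraph w fun _ => True).adj_of_eq (H := H) (by linarith)
    constructor
    · intro i j hij
      rw [weightGraph_adj] at hij
      exact (h4 i j hij.1).1 (by simpa using hij.2)
    · intro i j hij
      rw [weightGraph_adj]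
      refine ⟨hij.ne, ?_⟩
      have := (h4 i j hij.ne).2
      by_contra hcon
      refine this ?_ hij
      push Not at hcon
      exact lt_of_le_of_ne hcon.1 hcon.2
  have hDb := hbetween D hD (left_mem_segment ℝ _ _)
  have hEb := hbetween E hE (right_mem_segment ℝ _ _)
  have hor : (degreeSequence D = degreeSequence (weightGraph w fun _ => False) ∧
        degreeSequence E = degreeSequence (weightGraph w fun _ => True)) ∨
      (degreeSequence E = degreeSequence (weightGraph w fun _ => False) ∧
        degreeSequence D = degreeSequence (weightGraph w fun _ => True)) := by
    have d1 := degreeSequence_mono hDb.1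
    have d2 := degreeSequence_mono hDb.2
    have e1 := degreeSequence_mono hEb.1
    have e2 := degreeSequence_mono hEb.2
    rcases hseg fun _ => False with h | h <;> rcases hseg fun _ => True with h' | h'
    · rw [h] at e1; rw [h'] at e2
      exact absurd (le_antisymm e1 e2) hne
    · exact Or.inl ⟨h.symm, h'.symm⟩
    · exact Or.inr ⟨h.symm, h'.symm⟩
    · rw [h] at d1; rw [h'] at d2
      exact absurd (le_antisymm d2 d1) hne
  have hab : ∃ a b, a ≠ b ∧ w a + w b = 0 := by
    by_contra! hcon
    have : weightGraph w (fun _ => False) = weightGraph w (fun _ => True) := by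
      ext i j
      rw [weightGraph_adj, weightGraph_adj]
      have := hcon i j
      tauto
    rw [this] at hor
    rcases hor with ⟨h, h'⟩ | ⟨h, h'⟩
    · exact hne (h.trans h'.symm)
    · exact hne (h'.trans h.symm)
  obtain ⟨a, b, hab, hsum⟩ := hab
  refine ⟨w, hw, a, b, hab, hsum, ?_, hor⟩
  -- Adding only the class of `|w a|` already leaves the lower endpoint, so it must reach the upper
  -- one; a second class would give a third vertex on the segment.
  have hlt : degreeSequence (weightGraph w fun _ => False) ≠
      degreeSequence (weightGraph w (· = |w a|)) := by
    intro h
    have := congrFun h a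
    rw [degreeSequence_apply, degreeSequence_apply] at this
    have h2 : natDegree (weightGraph w fun _ => False) a <
        natDegree (weightGraph w (· = |w a|)) a :=
      natDegree_lt_of_imp (x := b) (fun j hj => weightGraph_mono w (fun _ h => h.elim) hj)
        (by rw [weightGraph_adj]; exact ⟨hab, Or.inr ⟨hsum, rfl⟩⟩)
        (by rw [weightGraph_adj]; simp [hsum])
    exact h2.ne (by exact_mod_cast this)
  have heq : degreeSequence (weightGraph w (· = |w a|)) =
      degreeSequence (weightGraph w fun _ => True) := by
    have := hseg (· = |w a|)
    rcases hor with ⟨h, h'⟩ | ⟨h, h'⟩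
    · rw [h, h'] at this; exact this.resolve_left hlt.symm
    · rw [h, h'] at this; exact this.resolve_right hlt.symm
  intro i j hij hs
  by_contra hcon
  have h2 : natDegree (weightGraph w (· = |w a|)) i < natDegree (weightGraph w fun _ => True) i :=
    natDegree_lt_of_imp (x := j) (fun j hj => weightGraph_mono w (fun _ _ => trivial) hj)
      (by rw [weightGraph_adj]; exact ⟨hij, Or.inr ⟨hs, trivial⟩⟩)
      (by rw [weightGraph_adj]; simp [hs, hcon])
  have := congrFun heq i
  rw [degreeSequence_apply, degreeSequence_apply] at this
  exact h2.ne (by exact_mod_cast this)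

/-! ### Exposing the segment for a given difference. -/

lemma natDegree_lt {n : ℕ} (G : SimpleGraph (Fin n)) (i : Fin n) : natDegree G i < n := by
  classical
  have : Finset.univ.filter (G.Adj i) ⊂ Finset.univ :=
    (Finset.ssubset_iff_of_subset (Finset.subset_univ _)).2 ⟨i, by simp, by simp⟩
  simpa [natDegree] using Finset.card_lt_card this

lemma IsShifted.le_of_natDegree_le {n : ℕ} {E F : SimpleGraph (Fin n)} (hE : IsShifted E)
    (hF : IsShifted F) (h : ∀ i, natDegree E i ≤ natDegree F i) : E ≤ F := by
  intro i j hij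
  rcases lt_or_gt_of_ne hij.ne with hlt | hlt
  · exact (hF.adj_iff_le hlt).2 (((hE.adj_iff_le hlt).1 hij).trans (h i))
  · exact ((hF.adj_iff_le hlt).2 (((hE.adj_iff_le hlt).1 hij.symm).trans (h j))).symm

/-- Degrees at the two ends of the support of the difference of two nested shifted graphs. -/
lemma natDegree_endpoints {n : ℕ} {E F : SimpleGraph (Fin n)} (hE : IsShifted E)
    (hF : IsShifted F) (h : ∀ i, natDegree E i ≤ natDegree F i) {a b : Fin n} (hab : a < b)
    (hsupp : ∀ x, natDegree E x < natDegree F x → a ≤ x ∧ x ≤ b)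
    (ha : natDegree E a < natDegree F a) (hb : natDegree E b < natDegree F b) :
    natDegree F a = b ∧ natDegree E b = a := by
  have hEF := hE.le_of_natDegree_le hF h
  have hex : ∀ z, natDegree E z < natDegree F z → ∃ x, F.Adj z x ∧ ¬ E.Adj z x := by
    intro z hz
    by_contra! hcon
    exact absurd (natDegree_le_of_imp hcon) (not_le.2 hz)
  have hlt : ∀ z x, F.Adj z x → ¬ E.Adj z x → a ≤ x ∧ x ≤ b := fun z x h1 h2 =>
    hsupp x (natDegree_lt_of_imp (fun j hj => hEF hj) h1.symm fun h => h2 h.symm)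
  obtain ⟨x, hax, hax'⟩ := hex a ha
  obtain ⟨y, hby, hby'⟩ := hex b hb
  have hx := hlt a x hax hax'
  have hy := hlt b y hby hby'
  have hnE : ¬ E.Adj a b := fun h => hax' (hE b x a hx.2 hax.ne' h.symm).symm
  have hFab : F.Adj a b := hF y a b hy.1 hab.ne hby.symm
  constructor
  · refine le_antisymm ?_ ((hF.adj_iff_le hab).1 hFab)
    by_contra! hcon
    have hn := natDegree_lt F a
    -- If `a` had degree above `b` in `F`, then `b + 1` would be a new neighbour of `a`, since `E`
    -- has no edge from `a` to `b` or beyond; its degree would grow outside the support.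
    let z : Fin n := ⟨b + 1, by omega⟩
    have hbz : b < z := Fin.lt_def.2 (Nat.lt_succ_self _)
    have hFz : F.Adj a z := (hF.adj_iff_le (hab.trans hbz)).2 hcon
    by_cases hEz : E.Adj a z
    · exact hnE (hE z b a hbz.le hab.ne' hEz.symm).symm
    · exact absurd (hlt a z hFz hEz).2 (not_le.2 hbz)
  · refine le_antisymm (not_lt.1 (mt (hE.adj_iff_lt hab).2 hnE)) ?_
    by_contra! hcon
    have hn := natDegree_lt E b
    -- This is the first non-neighbour of `b` in `E`; as it precedes `a` and `ab` is an edge of `F`,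
    -- it gains the edge to `b` outside the support.
    let z : Fin n := ⟨natDegree E b, hn⟩
    have hza : z < a := Fin.lt_def.2 hcon
    have hEz : ¬ E.Adj z b := by
      rw [hE.adj_iff_lt (hza.trans hab)]
      exact lt_irrefl _
    have hFz : F.Adj z b := hF a z b hza.le (hza.trans hab).ne hFab
    exact absurd (hlt b z hFz.symm fun h => hEz h.symm).1 (not_le.2 hza)

/-- A criterion for the segment between the degree sequences of two nested shifted graphs to be
exposed. -/
lemma isExposed_segment_of_weight {n : ℕ} {E F : SimpleGraph (Fin n)} (hE : IsShifted E)
    (hF : IsShifted F) (hEF : E ≤ F) (w p : Fin n → ℝ)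
    (hw : ∀ i j, i < j → (E.Adj i j ∧ 0 < w i + w j) ∨ (¬ F.Adj i j ∧ w i + w j < 0) ∨
      (¬ E.Adj i j ∧ F.Adj i j ∧ w i + w j = 0))
    (hp : ∀ g, Antitone g → p ⬝ᵥ g ≤ 0) (hpE : p ⬝ᵥ degreeSequence E = 0)
    (hpF : p ⬝ᵥ degreeSequence F = 0)
    (hface : ∀ g, Antitone g → degreeSequence E ≤ g → g ≤ degreeSequence F → p ⬝ᵥ g = 0 →
      w ⬝ᵥ g = w ⬝ᵥ degreeSequence E → g ∈ segment ℝ (degreeSequence E) (degreeSequence F)) :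
    IsExposed ℝ (degreePartitionPolytope n)
      (segment ℝ (degreeSequence E) (degreeSequence F)) := by
  intro _
  have hw' : ∀ i j, i ≠ j → (E.Adj i j ∧ 0 < w i + w j) ∨ (¬ F.Adj i j ∧ w i + w j < 0) ∨
      (¬ E.Adj i j ∧ F.Adj i j ∧ w i + w j = 0) := by
    intro i j hij
    rcases lt_or_gt_of_ne hij with h | h
    · exact hw i j h
    · rw [add_comm, E.adj_comm, F.adj_comm]; exact hw j i h
  have hEo : IsOptimal w E := by
    intro i j hij
    have h1 := hw' i j hij
    have h2 : E.Adj i j → F.Adj i j := fun h => hEF h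
    grind
  have hFo : IsOptimal w F := by
    intro i j hij
    have h1 := hw' i j hij
    have h2 : E.Adj i j → F.Adj i j := fun h => hEF h
    grind
  have heq : w ⬝ᵥ degreeSequence F = w ⬝ᵥ degreeSequence E := le_antisymm (hEo.le F) (hFo.le E)
  have hEm := subset_convexHull ℝ _ hE.mem_degreePartitions
  have hFm := subset_convexHull ℝ _ hF.mem_degreePartitions
  have hmax : ∀ y ∈ degreePartitionPolytope n, (w + p) ⬝ᵥ y ≤ w ⬝ᵥ degreeSequence E ∧
      ((w + p) ⬝ᵥ y = w ⬝ᵥ degreeSequence E →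
        y ∈ segment ℝ (degreeSequence E) (degreeSequence F)) := by
    intro y hy
    refine mem_of_mem_convexHull_of_le (convex_segment _ _) ?_ ?_ hy
    · intro s hs
      obtain ⟨hs, H, rfl⟩ := mem_degreePartitions_iff.1 hs
      rw [add_dotProduct]
      linarith [hEo.le H, hp _ hs]
    · intro s hs hs'
      obtain ⟨hs, H, rfl⟩ := mem_degreePartitions_iff.1 hs
      rw [add_dotProduct] at hs'
      have h1 := hEo.le H
      have h2 := hp _ hs
      have h3 : w ⬝ᵥ degreeSequence H = w ⬝ᵥ degreeSequence E := by linarith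
      have h4 := hEo.adj_of_eq h3
      refine hface _ hs (degreeSequence_mono ?_) (degreeSequence_mono ?_) (by linarith) h3
      · intro i j hij
        have h5 := h4 i j hij.ne
        have h6 := hw' i j hij.ne
        have h7 : F.Adj i j := hEF hij
        tauto
      · intro i j hij
        have h5 := h4 i j hij.ne
        have h6 := hw' i j hij.ne
        have h7 : E.Adj i j → F.Adj i j := fun h => hEF h
        tauto
  refine ⟨dotFunctional (w + p), Set.Subset.antisymm ?_ ?_⟩
  · intro x hx
    have hxv : (w + p) ⬝ᵥ x = w ⬝ᵥ degreeSequence E := by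
      obtain ⟨a, b, -, -, hab, rfl⟩ := hx
      rw [dotProduct_add, dotProduct_smul, dotProduct_smul, add_dotProduct, add_dotProduct,
        hpE, hpF, heq, smul_eq_mul, smul_eq_mul, add_zero, ← add_mul, hab, one_mul]
    refine ⟨(convex_convexHull ℝ _).segment_subset hEm hFm hx, fun y hy => ?_⟩
    rw [dotFunctional_apply, dotFunctional_apply, hxv]
    exact (hmax y hy).1
  · rintro x ⟨hx, hx'⟩
    refine (hmax x hx).2 (le_antisymm (hmax x hx).1 ?_)
    have := hx' _ hEm
    rw [dotFunctional_apply, dotFunctional_apply] at this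
    rwa [add_dotProduct, hpE, add_zero] at this

/-- All degrees on the interval are `a` in `E` and `b` in `F`: the interval is independent in `E`
and a clique in `F`. The weight is that of `IsShifted.mem_extremePoints` for `E`, replaced by `0` on
the interval. The functional `p` compares the two ends of the interval, so an antitone vector with
`p ⬝ᵥ g = 0` is constant there. -/
lemma isExposed_segment_of_omega {n : ℕ} {E F : SimpleGraph (Fin n)} (hE : IsShifted E)
    (hF : IsShifted F) {a b : Fin n} (hab : a < b)
    (hd : degreeSequence F - degreeSequence E = omega (Finset.Icc a b)) :
    IsExposed ℝ (degreePartitionPolytope n)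
      (segment ℝ (degreeSequence E) (degreeSequence F)) := by
  have hab' : (a : ℕ) < b := hab
  have hdx : ∀ x, natDegree F x = natDegree E x + if a ≤ x ∧ x ≤ b then (b : ℕ) - a else 0 := by
    intro x
    have h1 := congrFun hd x
    rw [Pi.sub_apply, degreeSequence_apply, degreeSequence_apply, omega, Fin.card_Icc,
      sub_eq_iff_eq_add'] at h1
    simp only [Finset.mem_Icc] at h1
    split_ifs at h1 ⊢ with h
    · rw [show (b : ℕ) + 1 - a = (b - a) + 1 by omega] at h1
      push_cast at h1
      rw [add_sub_cancel_right] at h1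
      exact_mod_cast h1
    · exact_mod_cast h1
  have hin : ∀ x, a ≤ x ∧ x ≤ b → natDegree F x = natDegree E x + (b - a) := fun x hx => by
    rw [hdx, if_pos hx]
  have hout : ∀ x, ¬ (a ≤ x ∧ x ≤ b) → natDegree F x = natDegree E x := fun x hx => by
    rw [hdx, if_neg hx, add_zero]
  have hle : ∀ x, natDegree E x ≤ natDegree F x := fun x => by rw [hdx]; omega
  have hEF := hE.le_of_natDegree_le hF hle
  have haI := hin a ⟨le_rfl, hab.le⟩
  have hbI := hin b ⟨hab.le, le_rfl⟩
  obtain ⟨hFa, hEb⟩ := natDegree_endpoints hE hF hle hab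
    (fun x hx => by by_contra h; rw [hout x h] at hx; exact lt_irrefl _ hx)
    (by omega) (by omega)
  have hanti : ∀ x y, x ≤ y → natDegree E y ≤ natDegree E x := fun x y hxy => by
    have := hE.antitone hxy
    rw [degreeSequence_apply, degreeSequence_apply] at this
    exact_mod_cast this
  have hEI : ∀ x, a ≤ x ∧ x ≤ b → natDegree E x = a := fun x hx => by
    have h1 := hanti _ _ hx.1
    have h2 := hanti _ _ hx.2
    omega
  set W : Fin n → ℤ := fun x => if a ≤ x ∧ x ≤ b then 0 else (natDegree E x : ℤ) - (x : ℕ) with hW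
  set p : Fin n → ℝ := Pi.single b 1 - Pi.single a 1 with hp
  have hpg : ∀ g : Fin n → ℝ, p ⬝ᵥ g = g b - g a := fun g => by
    rw [hp, sub_dotProduct, single_one_dotProduct, single_one_dotProduct]
  refine isExposed_segment_of_weight hE hF hEF (fun x => (W x : ℝ)) p ?_ ?_ ?_ ?_ ?_
  · intro x y hxy
    have hxy' : (x : ℕ) < y := hxy
    have key : (E.Adj x y ∧ 0 < W x + W y) ∨ (¬ F.Adj x y ∧ W x + W y < 0) ∨
      (¬ E.Adj x y ∧ F.Adj x y ∧ W x + W y = 0) := by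
      have h1 := hE.adj_iff_le hxy
      have h2 := hE.adj_iff_lt hxy
      rw [hE.adj_iff_le hxy, hF.adj_iff_le hxy]
      rw [hE.adj_iff_le hxy] at h2
      have h3 := hF.adj_iff_lt hxy
      rw [hF.adj_iff_le hxy] at h3
      simp only [hW]
      by_cases hx : a ≤ x ∧ x ≤ b <;> by_cases hy : a ≤ y ∧ y ≤ b
      · rw [if_pos hx, if_pos hy]
        have := hin x hx
        have := hEI x hx
        have := hx.1; have := hy.2
        omega
      · rw [if_pos hx, if_neg hy]
        have := hin x hx
        have := hEI x hx
        have := hout y hy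
        omega
      · rw [if_neg hx, if_pos hy]
        have := hin y hy
        have := hEI y hy
        have := hout x hx
        have hxb : x < b := hxy.trans_le hy.2
        have h4 := hE.adj_iff_lt hxb
        rw [hE.adj_iff_le hxb] at h4
        omega
      · rw [if_neg hx, if_neg hy]
        have := hout x hx
        have := hout y hy
        omega
    rcases key with ⟨h1, h2⟩ | ⟨h1, h2⟩ | ⟨h1, h2, h3⟩
    · exact Or.inl ⟨h1, by exact_mod_cast h2⟩
    · exact Or.inr (Or.inl ⟨h1, by exact_mod_cast h2⟩)
    · exact Or.inr (Or.inr ⟨h1, h2, by exact_mod_cast h3⟩)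
  · intro g hg
    rw [hpg]
    linarith [hg hab.le]
  · rw [hpg, degreeSequence_apply, degreeSequence_apply, hEI a ⟨le_rfl, hab.le⟩, hEb, sub_self]
  · rw [hpg, degreeSequence_apply, degreeSequence_apply, haI, hbI, hEI a ⟨le_rfl, hab.le⟩, hEb,
      sub_self]
  · intro g hg hEg hgF hpz _
    rw [hpg] at hpz
    have hbpos : (0 : ℝ) < (b : ℕ) - (a : ℕ) := by
      have : ((a : ℕ) : ℝ) < (b : ℕ) := by exact_mod_cast hab'
      linarith
    have hsub : ((b - a : ℕ) : ℝ) = (b : ℕ) - (a : ℕ) := Nat.cast_sub hab'.le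
    have hg1 := hEg a
    have hg2 := hgF a
    rw [degreeSequence_apply] at hg1 hg2
    rw [haI, Nat.cast_add, hsub] at hg2
    rw [segment_eq_image']
    refine ⟨(g a - natDegree E a) / ((b : ℕ) - (a : ℕ)), ⟨?_, ?_⟩, ?_⟩
    · exact div_nonneg (by linarith) hbpos.le
    · rw [div_le_one hbpos]; linarith
    · funext x
      simp only [Pi.add_apply, Pi.smul_apply, Pi.sub_apply, smul_eq_mul, degreeSequence_apply]
      by_cases hx : a ≤ x ∧ x ≤ b
      · rw [hin x hx, hEI x hx, hEI a ⟨le_rfl, hab.le⟩]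
        have h1 := hg hx.1
        have h2 := hg hx.2
        rw [Nat.cast_add, hsub, add_sub_cancel_left, div_mul_cancel₀ _ hbpos.ne']
        linarith
      · have h1 := hEg x
        have h2 := hgF x
        rw [degreeSequence_apply] at h1 h2
        rw [hout x hx] at h2 ⊢
        rw [sub_self, mul_zero, add_zero]
        linarith

/-- In `E` the degrees are `c - 1` on the first interval and `a` on the second; `F` adds all edges
between the two. The weights `±(c - b)` there make these edges zero-sum. A vertex `z` strictly
between the intervals has `|deg z - z| ≤ c - b - 2`, so its pairs with either interval keep the
right sign. -/
lemma isExposed_segment_of_omegaPair {n : ℕ} {E F : SimpleGraph (Fin n)} (hE : IsShifted E)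
    (hF : IsShifted F) {a b c d : Fin n} (hab : a ≤ b) (hbc : b < c) (hcd : c ≤ d)
    (hd : degreeSequence F - degreeSequence E = omegaPair (Finset.Icc a b) (Finset.Icc c d)) :
    IsExposed ℝ (degreePartitionPolytope n)
      (segment ℝ (degreeSequence E) (degreeSequence F)) := by
  have hab' : (a : ℕ) ≤ b := hab
  have hbc' : (b : ℕ) < c := hbc
  have hcd' : (c : ℕ) ≤ d := hcd
  have hdx : ∀ x, natDegree F x = natDegree E x + if a ≤ x ∧ x ≤ b then (d : ℕ) + 1 - c else
      if c ≤ x ∧ x ≤ d then (b : ℕ) + 1 - a else 0 := by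
    intro x
    have h1 := congrFun hd x
    rw [Pi.sub_apply, degreeSequence_apply, degreeSequence_apply, omegaPair, Fin.card_Icc,
      Fin.card_Icc, sub_eq_iff_eq_add'] at h1
    simp only [Finset.mem_Icc] at h1
    split_ifs at h1 ⊢ with h <;> exact_mod_cast h1
  have hI : ∀ x, a ≤ x ∧ x ≤ b → natDegree F x = natDegree E x + (d + 1 - c) := fun x hx => by
    rw [hdx, if_pos hx]
  have hJI : ∀ x, c ≤ x ∧ x ≤ d → ¬ (a ≤ x ∧ x ≤ b) := fun x hx h =>
    absurd (hbc.trans_le (hx.1.trans h.2)) (lt_irrefl _)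
  have hJ : ∀ x, c ≤ x ∧ x ≤ d → natDegree F x = natDegree E x + (b + 1 - a) := fun x hx => by
    rw [hdx, if_neg (hJI x hx), if_pos hx]
  have hout : ∀ x, ¬ (a ≤ x ∧ x ≤ b) → ¬ (c ≤ x ∧ x ≤ d) → natDegree F x = natDegree E x :=
    fun x hx hx' => by rw [hdx, if_neg hx, if_neg hx', add_zero]
  have hle : ∀ x, natDegree E x ≤ natDegree F x := fun x => by rw [hdx]; omega
  have hEF := hE.le_of_natDegree_le hF hle
  have haI := hI a ⟨le_rfl, hab⟩
  have hbI := hI b ⟨hab, le_rfl⟩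
  have hcJ := hJ c ⟨le_rfl, hcd⟩
  have hdJ := hJ d ⟨hcd, le_rfl⟩
  obtain ⟨hFa, hEd⟩ := natDegree_endpoints hE hF hle (hab.trans_lt (hbc.trans_le hcd))
    (fun x hx => by
      by_cases h : a ≤ x ∧ x ≤ b
      · exact ⟨h.1, h.2.trans (hbc.le.trans hcd)⟩
      · by_cases h' : c ≤ x ∧ x ≤ d
        · exact ⟨hab.trans (hbc.le.trans h'.1), h'.2⟩
        · rw [hout x h h'] at hx; exact absurd hx (lt_irrefl _))
    (by omega) (by omega)
  have hanti : ∀ x y, x ≤ y → natDegree E y ≤ natDegree E x := fun x y hxy => by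
    have := hE.antitone hxy
    rw [degreeSequence_apply, degreeSequence_apply] at this
    exact_mod_cast this
  have hEdual : ∀ x y : Fin n, x < y → ((y : ℕ) ≤ natDegree E x ↔ (x : ℕ) < natDegree E y) :=
    fun x y h => (hE.adj_iff_le h).symm.trans (hE.adj_iff_lt h)
  have hFdual : ∀ x y : Fin n, x < y → ((y : ℕ) ≤ natDegree F x ↔ (x : ℕ) < natDegree F y) :=
    fun x y h => (hF.adj_iff_le h).symm.trans (hF.adj_iff_lt h)
  have hEI : ∀ x, a ≤ x ∧ x ≤ b → natDegree E x + 1 = c := fun x hx => by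
    have h1 := hanti _ _ hx.1
    have h2 := hanti _ _ hx.2
    -- The degree of `d` in `F` is `b + 1`, so `b` is adjacent to `d` in `F`; this bounds the degree
    -- of `b` from below.
    have h3 := hFdual b d (hbc.trans_le hcd)
    omega
  have hEJ : ∀ x, c ≤ x ∧ x ≤ d → natDegree E x = a := fun x hx => by
    have h1 := hanti _ _ hx.1
    have h2 := hanti _ _ hx.2
    have h3 := hEdual a c (hab.trans_lt hbc)
    have h4 := hEI a ⟨le_rfl, hab⟩
    omega
  set W : Fin n → ℤ := fun x => if a ≤ x ∧ x ≤ b then (c : ℕ) - (b : ℕ) else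
    if c ≤ x ∧ x ≤ d then (b : ℕ) - (c : ℕ) else (natDegree E x : ℤ) - (x : ℕ) with hW
  set p : Fin n → ℝ := Pi.single b 1 - Pi.single a 1 + (Pi.single d 1 - Pi.single c 1) with hp
  have hpg : ∀ g : Fin n → ℝ, p ⬝ᵥ g = g b - g a + (g d - g c) := fun g => by
    rw [hp, add_dotProduct, sub_dotProduct, sub_dotProduct, single_one_dotProduct,
      single_one_dotProduct, single_one_dotProduct, single_one_dotProduct]
  have hEa := hEI a ⟨le_rfl, hab⟩
  have hEb := hEI b ⟨hab, le_rfl⟩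
  have hEc := hEJ c ⟨le_rfl, hcd⟩
  have hEab : natDegree E b = natDegree E a := by omega
  refine isExposed_segment_of_weight hE hF hEF (fun x => (W x : ℝ)) p ?_ ?_ ?_ ?_ ?_
  · intro x y hxy
    have hxy' : (x : ℕ) < y := hxy
    have key : (E.Adj x y ∧ 0 < W x + W y) ∨ (¬ F.Adj x y ∧ W x + W y < 0) ∨
      (¬ E.Adj x y ∧ F.Adj x y ∧ W x + W y = 0) := by
      rw [hE.adj_iff_le hxy, hF.adj_iff_le hxy]
      have h2 := hEdual x y hxy
      have h3 := hFdual x y hxy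
      have hWI : ∀ z, a ≤ z ∧ z ≤ b → W z = (c : ℕ) - (b : ℕ) := fun z hz => if_pos hz
      have hWJ : ∀ z, c ≤ z ∧ z ≤ d → W z = (b : ℕ) - (c : ℕ) := fun z hz => by
        simp only [hW, if_neg (hJI z hz), if_pos hz]
      have hWo : ∀ z, ¬ (a ≤ z ∧ z ≤ b) → ¬ (c ≤ z ∧ z ≤ d) →
          W z = (natDegree E z : ℤ) - (z : ℕ) := fun z hz hz' => by
        simp only [hW, if_neg hz, if_neg hz']
      have e1 := hEdual b y
      have e2 := hFdual a y
      have e3 := hEdual x d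
      have e4 := hFdual x c
      clear_value W
      clear hdx hEF hJI hle hanti hd hpg hW hp p
      by_cases hx : a ≤ x ∧ x ≤ b
      · have hx1 := hI x hx
        have hx2 := hEI x hx
        have hx3 := hWI x hx
        by_cases hy : a ≤ y ∧ y ≤ b
        · have hy1 := hI y hy
          have hy2 := hEI y hy
          have hy3 := hWI y hy
          clear e1 e2 e3 e4
          omega
        · by_cases hy' : c ≤ y ∧ y ≤ d
          · have hy1 := hJ y hy'
            have hy2 := hEJ y hy'
            have hy3 := hWJ y hy'
            clear e1 e2 e3 e4
            omega
          · have hy1 := hout y hy hy'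
            have hy3 := hWo y hy hy'
            clear e3 e4
            omega
      · by_cases hx' : c ≤ x ∧ x ≤ d
        · have hx1 := hJ x hx'
          have hx2 := hEJ x hx'
          have hx3 := hWJ x hx'
          have hy : ¬ (a ≤ y ∧ y ≤ b) := by omega
          by_cases hy' : c ≤ y ∧ y ≤ d
          · have hy1 := hJ y hy'
            have hy2 := hEJ y hy'
            have hy3 := hWJ y hy'
            clear e1 e2 e3 e4
            omega
          · have hy1 := hout y hy hy'
            have hy3 := hWo y hy hy'
            clear e1 e3 e4
            omega
        · have hx1 := hout x hx hx'
          have hx3 := hWo x hx hx'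
          by_cases hy : a ≤ y ∧ y ≤ b
          · have hy1 := hI y hy
            have hy2 := hEI y hy
            have hy3 := hWI y hy
            clear e1 e2 e4
            omega
          · by_cases hy' : c ≤ y ∧ y ≤ d
            · have hy1 := hJ y hy'
              have hy2 := hEJ y hy'
              have hy3 := hWJ y hy'
              clear e1 e2
              omega
            · have hy1 := hout y hy hy'
              have hy3 := hWo y hy hy'
              clear e1 e2 e3 e4
              omega
    rcases key with ⟨h1, h2⟩ | ⟨h1, h2⟩ | ⟨h1, h2, h3⟩
    · exact Or.inl ⟨h1, by exact_mod_cast h2⟩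
    · exact Or.inr (Or.inl ⟨h1, by exact_mod_cast h2⟩)
    · exact Or.inr (Or.inr ⟨h1, h2, by exact_mod_cast h3⟩)
  · intro g hg
    rw [hpg]
    linarith [hg hab, hg hcd]
  · rw [hpg]
    simp only [degreeSequence_apply]
    rw [hEab, hEc, hEd]
    simp
  · rw [hpg]
    simp only [degreeSequence_apply]
    rw [haI, hbI, hcJ, hdJ, hEab, hEc, hEd]
    simp
  · intro g hg hEg hgF hpz hwz
    rw [hpg] at hpz
    have hgab := hg hab
    have hgcd := hg hcd
    set r := g a - natDegree E a with hr
    set s := g c - natDegree E c with hs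
    have hgI : ∀ x, a ≤ x ∧ x ≤ b → g x - degreeSequence E x = r := fun x hx => by
      have h1 := hg hx.1
      have h2 := hg hx.2
      have h3 : natDegree E x = natDegree E a := by have := hEI x hx; omega
      rw [degreeSequence_apply, h3, hr]
      linarith
    have hgJ : ∀ x, c ≤ x ∧ x ≤ d → g x - degreeSequence E x = s := fun x hx => by
      have h1 := hg hx.1
      have h2 := hg hx.2
      rw [degreeSequence_apply, hEJ x hx, hs, hEc]
      linarith
    have hgo : ∀ x, ¬ (a ≤ x ∧ x ≤ b) → ¬ (c ≤ x ∧ x ≤ d) → g x = degreeSequence E x := by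
      intro x hx hx'
      have h1 := hEg x
      have h2 := hgF x
      rw [degreeSequence_apply, hout x hx hx', ← degreeSequence_apply] at h2
      exact le_antisymm h2 h1
    set A : ℝ := (((b : ℕ) + 1 - (a : ℕ) : ℕ) : ℝ) with hA
    set C : ℝ := (((d : ℕ) + 1 - (c : ℕ) : ℕ) : ℝ) with hC
    have hApos : 0 < A := by rw [hA]; exact_mod_cast (by omega : 0 < (b : ℕ) + 1 - a)
    have hCpos : 0 < C := by rw [hC]; exact_mod_cast (by omega : 0 < (d : ℕ) + 1 - c)
    -- Constancy on both intervals still leaves two free increments `r` and `s`. The functional `w`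
    -- supplies the missing relation, `(c - b)(A r - C s) = 0`, so `(r, s)` is a multiple of `(C,
    -- A)`.
    have hbal : A * r = C * s := by
      have hv : (0 : ℝ) < (c : ℕ) - (b : ℕ) := by
        have : ((b : ℕ) : ℝ) < (c : ℕ) := by exact_mod_cast hbc'
        linarith
      have h0 : (fun x => (W x : ℝ)) ⬝ᵥ (g - degreeSequence E) = 0 := by
        rw [dotProduct_sub, hwz, sub_self]
      have h1 : (fun x => (W x : ℝ)) ⬝ᵥ (g - degreeSequence E) =
          ∑ x, ((if x ∈ Finset.Icc a b then ((c : ℕ) - (b : ℕ) : ℝ) * r else 0) -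
            (if x ∈ Finset.Icc c d then ((c : ℕ) - (b : ℕ) : ℝ) * s else 0)) := by
        refine Finset.sum_congr rfl fun x _ => ?_
        simp only [Pi.sub_apply, Finset.mem_Icc, hW]
        by_cases hx : a ≤ x ∧ x ≤ b
        · have hx' : ¬ (c ≤ x ∧ x ≤ d) := fun h => hJI x h hx
          rw [hgI x hx, if_pos hx, if_pos hx, if_neg hx']
          push_cast
          ring
        · by_cases hx' : c ≤ x ∧ x ≤ d
          · rw [hgJ x hx', if_neg hx, if_pos hx', if_neg hx, if_pos hx']
            push_cast
            ring
          · rw [hgo x hx hx', if_neg hx, if_neg hx', if_neg hx, if_neg hx']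
            simp
      rw [h0, Finset.sum_sub_distrib, Finset.sum_ite_mem, Finset.sum_ite_mem, Finset.univ_inter,
        Finset.univ_inter, Finset.sum_const, Finset.sum_const, Fin.card_Icc, Fin.card_Icc,
        nsmul_eq_mul, nsmul_eq_mul, ← hA, ← hC] at h1
      refine mul_left_cancel₀ hv.ne' ?_
      linarith
    have hg1 := hEg a
    have hg2 := hgF a
    rw [degreeSequence_apply] at hg1 hg2
    rw [haI, Nat.cast_add, ← hC] at hg2
    rw [segment_eq_image']
    refine ⟨r / C, ⟨div_nonneg (by linarith) hCpos.le, ?_⟩, ?_⟩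
    · rw [div_le_one hCpos]; linarith
    · funext x
      rw [hd]
      simp only [Pi.add_apply, Pi.smul_apply, smul_eq_mul, omegaPair, Finset.mem_Icc,
        Fin.card_Icc, ← hA, ← hC]
      by_cases hx : a ≤ x ∧ x ≤ b
      · rw [if_pos hx, div_mul_cancel₀ _ hCpos.ne', ← hgI x hx]
        ring
      · rw [if_neg hx]
        by_cases hx' : c ≤ x ∧ x ≤ d
        · rw [if_pos hx', div_mul_eq_mul_div, mul_comm r A, hbal, mul_div_cancel_left₀ _ hCpos.ne',
            ← hgJ x hx']
          ring
        · rw [if_neg hx', hgo x hx hx']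
          simp

/-! ### Adjacency and the main theorem. -/

/-- Threshold partitions differing by a vector `Ω_I` or `Ω_{I,J}` are adjacent. -/
lemma adjacentExtremePoints_of_le {n : ℕ} {d e : Fin n → ℝ} (hd : d ∈ thresholdPartitions n)
    (he : e ∈ thresholdPartitions n)
    (h : (∃ I : Finset (Fin n), IsInterval I ∧ 2 ≤ I.card ∧ e - d = omega I) ∨
      (∃ I J : Finset (Fin n), IsInterval I ∧ IsInterval J ∧ (∀ i ∈ I, ∀ j ∈ J, i < j) ∧
        e - d = omegaPair I J)) :
    AdjacentExtremePoints (degreePartitionPolytope n) d e := by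
  obtain ⟨E, hE, rfl⟩ := exists_isShifted_of_mem_thresholdPartitions hd
  obtain ⟨F, hF, rfl⟩ := exists_isShifted_of_mem_thresholdPartitions he
  refine ⟨hE.mem_extremePoints, hF.mem_extremePoints, ?_, ?_⟩
  · intro heq
    rw [heq, sub_self] at h
    rcases h with ⟨I, ⟨i, j, hij, rfl⟩, hc, h⟩ | ⟨I, J, ⟨i, j, hij, rfl⟩, ⟨k, l, hkl, rfl⟩, -, h⟩
    · have h := congrFun h i
      rw [omega, if_pos (by simpa using hij)] at h
      have hc : (2 : ℝ) ≤ (Finset.Icc i j).card := by exact_mod_cast hc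
      rw [Pi.zero_apply] at h
      linarith
    · have h := congrFun h i
      rw [omegaPair, if_pos (by simpa using hij), Pi.zero_apply, eq_comm, Nat.cast_eq_zero,
        Finset.card_eq_zero] at h
      exact Finset.notMem_empty k (h ▸ Finset.left_mem_Icc.2 hkl)
  · rcases h with ⟨I, ⟨i, j, hij, rfl⟩, hc, h⟩ | ⟨I, J, ⟨i, j, hij, rfl⟩, ⟨k, l, hkl, rfl⟩, hlt, h⟩
    · refine isExposed_segment_of_omega hE hF ?_ h
      rw [Fin.card_Icc] at hc
      exact Fin.lt_def.2 (by omega)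
    · exact isExposed_segment_of_omegaPair hE hF hij
        (hlt j (Finset.right_mem_Icc.2 hij) k (Finset.left_mem_Icc.2 hkl)) hkl h

lemma AdjacentExtremePoints.symm {n : ℕ} {P : Set (Fin n → ℝ)} {d e : Fin n → ℝ}
    (h : AdjacentExtremePoints P d e) : AdjacentExtremePoints P e d :=
  ⟨h.2.1, h.1, h.2.2.1.symm, by rw [segment_symm]; exact h.2.2.2⟩

end DegreePartitions

theorem mainTheorem4 (n : ℕ) (hn : 3 ≤ n) (d e : Fin n → ℝ)
    (hd : d ∈ DegreePartitions.thresholdPartitions n)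
    (he : e ∈ DegreePartitions.thresholdPartitions n) :
    DegreePartitions.AdjacentExtremePoints (DegreePartitions.degreePartitionPolytope n) d e ↔
      (d ≤ e ∨ e ≤ d) ∧
        ((∃ I : Finset (Fin n), DegreePartitions.IsInterval I ∧ 2 ≤ I.card ∧
            |d - e| = DegreePartitions.omega I) ∨
          (∃ I J : Finset (Fin n), DegreePartitions.IsInterval I ∧ DegreePartitions.IsInterval J ∧
            (∀ i ∈ I, ∀ j ∈ J, i < j) ∧ |d - e| = DegreePartitions.omegaPair I J)) := by
  open DegreePartitions in
  constructor
  · rintro ⟨-, -, hne, hexp⟩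
    obtain ⟨E, hE, rfl⟩ := exists_isShifted_of_mem_thresholdPartitions hd
    obtain ⟨F, hF, rfl⟩ := exists_isShifted_of_mem_thresholdPartitions he
    -- The endpoints are the smallest and the largest weight graph of one `w`; their nesting gives
    -- comparability and removes the absolute value.
    obtain ⟨w, hw, a, b, hab, hsum, hall, hor⟩ := exists_weight_of_isExposed hE hF hne hexp
    have hshape := weightGraph_sub_eq_omega hw hab hsum (abs_nonneg _) hall
    have hle : degreeSequence (weightGraph w fun _ => False) ≤
        degreeSequence (weightGraph w fun _ => True) :=
      degreeSequence_mono (weightGraph_mono w fun _ _ => trivial)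
    rcases hor with ⟨h1, h2⟩ | ⟨h1, h2⟩
    · rw [h1, h2, abs_sub_comm, abs_of_nonneg (sub_nonneg.2 hle)]
      exact ⟨Or.inl hle, hshape⟩
    · rw [h1, h2, abs_of_nonneg (sub_nonneg.2 hle)]
      exact ⟨Or.inr hle, hshape⟩
  · rintro ⟨hle | hle, h⟩
    · rw [abs_sub_comm, abs_of_nonneg (sub_nonneg.2 hle)] at h
      exact adjacentExtremePoints_of_le hd he h
    · rw [abs_of_nonneg (sub_nonneg.2 hle)] at h
      exact (adjacentExtremePoints_of_le he hd h).symm
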